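/- Let $m,n\ge 1$. A discrete memoryless channel (DMC) with input letters $0,\dots,m-1$ and output letters $0,\dots,n-1$ is given by an $m\times n$ stochastic matrix $Q=(q_{xy})$, $q_{xy}=p(y|x)$: $q_{xy}\ge 0$, $\sum_y q_{xy}=1$. View it as the quantum channel $$\mathcal Q(\rho)=\sum_{x,y}q_{xy}\,\langle x|\rho|x\rangle\,|y\rangle\langle y| ,$$ which maps the diagonal state $\mathrm{diag}(p_x)$ to the diagonal state $\mathrm{diag}\bigl(\sum_x p_xq_{xy}\bigr)_y$. A family $\{\mathcal E_t\}$ of quantum channels (completely positive trace-preserving maps) from $B$ to $B'$ is called programmable by $(\{\rho_t\},\mathcal G)$ if the $\rho_t$ are states of a finite-dimensional system $A$ and $\mathcal G$ is a quantum channel from $A\otimes B$ to some $A'\otimes B'$, not depending on $t$, with $\mathcal E_t(\sigma)=\mathrm{tr}_{A'}\,\mathcal G(\rho_t\otimes\sigma)$ for all $t$ and all states $\sigma$ of $B$. **(1) All DMCs are programmable.** The family of all channels $\mathcal Q$ with $m$ inputs and $n$ outputs is programmable with the pure program states $$\Bigl[\bigotimes_{x=0}^{m-1}\sum_{y=0}^{n-1}\sqrt{q_{xy}}\,|y\rangle\Bigr]\otimes|0\rangle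 ,$$ where the last factor $|0\rangle$ is a blank $n$-dimensional register, and with a single unitary gate. It is also programmable with the pure program states $\bigotimes_{x}\sum_y\sqrt{q_{xy}}\,|y\rangle$ without the blank register, with a single gate that is a quantum channel. **(2) No parameter of a DMC can be estimated faster than $\Omega(1/\sqrt N)$.** Let $\Theta$ be a finite-dimensional real $C^1$ manifold, possibly with boundary or corners, let $\theta\mapsto Q_\theta$ be a family of $m\times n$ stochastic matrices whose entries are differentiable on $\Theta$, and let $\tau:\Theta\to V$ be a $C^1$ map to a real normed space (the quantity to be estimated; for example $\tau(\theta)=\theta$ if $\Theta\subseteq\mathbb R^d$, or one coordinate of $\theta$) whose derivative is nonzero at at least one point of $\Theta$. An estimation protocol with $N$ uses of the unknown channel prepares a state of the channel input and a finite-dimensional reference system, uses the channel $N$ times with arbitrary quantum channels in between, performs a joint POVM with finitely many outcomes in the end, and assigns an estimate $\hat\tau\in V$ to each outcome. Write $\mathrm{RMSE}(\theta)=\bigl(E_\theta\|\hat\tau-\tau(\theta)\|^2\bigr)^{1/2}$ for its root mean squared error if the unknown channel is $\mathcal Q_\theta$. Then: * there is a constant $c>0$, depending only on the family and on $\tau$,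 such that for every $N\ge 1$ and every protocol with $N$ uses there is a $\theta\in\Theta$ with $\mathrm{RMSE}(\theta)\ge c/\sqrt N$; * there is no sequence of protocols, the $N$-th with $N$ uses, such that $\mathrm{RMSE}_N(\theta)=o(1/\sqrt N)$ as $N\to\infty$ for every $\theta\in\Theta$. -/

import Mathlib

open scoped ComplexOrder Kronecker Manifold

/-! ### States, channels, partial trace

Operators on the finite-dimensional Hilbert space `ℂ^ι` are complex matrices indexed by `ι`;
the tensor product of two spaces is indexed by the product type. -/

section Quantum

variable {ι κ α β : Type*} [Fintype ι] [Fintype κ] [Fintype α] [Fintype β]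

/-- Quantum states: positive semidefinite operators with unit trace. -/
def IsDensity (ρ : Matrix ι ι ℂ) : Prop :=
  ρ.PosSemidef ∧ ρ.trace = 1

/-- The superoperator `ℐ_R ⊗ Φ`, acting on an operator on `R ⊗ ι` (an `R × R` block matrix) by
applying `Φ` to every block. -/
def tensorId {R : Type*} (Φ : Matrix ι ι ℂ →ₗ[ℂ] Matrix κ κ ℂ)
    (X : Matrix (R × ι) (R × ι) ℂ) : Matrix (R × κ) (R × κ) ℂ :=
  Matrix.of fun p q => Φ (Matrix.of fun i j => X (p.1, i) (q.1, j)) p.2 q.2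

/-- Quantum channels: completely positive and trace-preserving superoperators. -/
def IsQuantumChannel (Φ : Matrix ι ι ℂ →ₗ[ℂ] Matrix κ κ ℂ) : Prop :=
  (∀ (r : ℕ) (X : Matrix (Fin r × ι) (Fin r × ι) ℂ),
      X.PosSemidef → (tensorId Φ X).PosSemidef) ∧
    ∀ X : Matrix ι ι ℂ, (Φ X).trace = X.trace

/-- The partial trace over the first tensor factor. -/
def traceFst (X : Matrix (α × β) (α × β) ℂ) : Matrix β β ℂ :=
  Matrix.of fun b b' => ∑ a, X (a, b) (a, b')

/-- The superoperator `X ↦ U X U†`. -/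
def conjBy (U : Matrix κ ι ℂ) : Matrix ι ι ℂ →ₗ[ℂ] Matrix κ κ ℂ where
  toFun X := U * X * U.conjTranspose
  map_add' X Y := by rw [Matrix.mul_add, Matrix.add_mul]
  map_smul' c X := by simp

/-- The pure state `|ψ⟩⟨ψ|`. -/
def pureState (ψ : ι → ℂ) : Matrix ι ι ℂ :=
  Matrix.vecMulVec ψ (star ψ)

/-- The family `{𝓔_t}` of quantum channels from `B` to `B'` is programmable by `({ρ_t}, 𝓖)`: the
`ρ_t` are states of a system `A`, the gate `𝓖 : A ⊗ B → A' ⊗ B'` does not depend on `t`, and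
`𝓔_t(σ) = tr_{A'} 𝓖(ρ_t ⊗ σ)` for all `t` and all states `σ` of `B`. -/
def IsProgrammableBy {T A A' B B' : Type*} [Fintype A] [Fintype A'] [Fintype B] [Fintype B']
    (𝓔 : T → Matrix B B ℂ →ₗ[ℂ] Matrix B' B' ℂ) (ρ : T → Matrix A A ℂ)
    (𝓖 : Matrix (A × B) (A × B) ℂ →ₗ[ℂ] Matrix (A' × B') (A' × B') ℂ) : Prop :=
  (∀ t, IsQuantumChannel (𝓔 t)) ∧ (∀ t, IsDensity (ρ t)) ∧ IsQuantumChannel 𝓖 ∧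
    ∀ (t : T) (σ : Matrix B B ℂ), IsDensity σ → 𝓔 t σ = traceFst (𝓖 (ρ t ⊗ₖ σ))

end Quantum

/-! ### Discrete memoryless channels -/

/-- The transition matrices `Q = (q_{xy})`, `q_{xy} = p(y|x)`, of the discrete memoryless channels
with `m` input letters and `n` output letters. -/
def StochasticMatrix (m n : ℕ) : Type :=
  {Q : Matrix (Fin m) (Fin n) ℝ // (∀ x y, 0 ≤ Q x y) ∧ ∀ x, ∑ y, Q x y = 1}

section DMC

variable {m n : ℕ}

/-- The discrete memoryless channel `Q` as a quantum channel. It sends the diagonal state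
`diag(p_x)` to the diagonal state `diag(∑ₓ pₓ q_{xy})`; an input that is not diagonal is first
measured in the computational basis. -/
def dmcChannel (Q : StochasticMatrix m n) :
    Matrix (Fin m) (Fin m) ℂ →ₗ[ℂ] Matrix (Fin n) (Fin n) ℂ where
  toFun ρ := Matrix.diagonal fun y => ∑ x, ρ x x * (Q.1 x y : ℂ)
  map_add' ρ σ := by
    rw [Matrix.diagonal_add]
    simp [add_mul, Finset.sum_add_distrib]
  map_smul' c ρ := by
    rw [← Matrix.diagonal_smul]
    congr 1
    funext y
    simp [Finset.mul_sum, mul_assoc]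

/-- The vector `⊗ₓ v_x` of `(ℂⁿ)^{⊗ m}`, in the basis `|y_0 y_1 ⋯ y_{m-1}⟩`, which is indexed by
the functions `Fin m → Fin n`. -/
def tensorKet (v : Fin m → Fin n → ℂ) : (Fin m → Fin n) → ℂ :=
  fun f => ∏ x, v x (f x)

/-- The program vector `⊗ₓ ∑_y √q_{xy} |y⟩`. -/
noncomputable def programKet (Q : StochasticMatrix m n) : (Fin m → Fin n) → ℂ :=
  tensorKet fun x => ∑ y, ((√(Q.1 x y) : ℝ) : ℂ) • (Pi.single y 1 : Fin n → ℂ)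

/-- The program vector followed by a blank output register, `[⊗ₓ ∑_y √q_{xy} |y⟩] ⊗ |0⟩`. -/
noncomputable def programKetBlank [NeZero n] (Q : StochasticMatrix m n) :
    (Fin m → Fin n) × Fin n → ℂ :=
  fun p => programKet Q p.1 * (Pi.single 0 1 : Fin n → ℂ) p.2

end DMC

/-! ### Estimation protocols -/

/-- A protocol that uses an unknown channel from `B` to `B'` exactly `N` times and then outputs an
estimate in `V`. It prepares a state of `R₀ ⊗ B`, where the `R_k` are finite-dimensional reference
systems; the unknown channel acts on `B`, between two uses an arbitrary channel
`R_k ⊗ B' → R_{k+1} ⊗ B` is applied, and in the end there is a joint measurement (a POVM) with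
finitely many outcomes, each with its estimate. Parallel, sequential and adaptive strategies,
entangled inputs and randomized estimators are all of this form. -/
structure EstimationProtocol (B B' : Type) [Fintype B] [Fintype B'] [DecidableEq B]
    (N : ℕ) (V : Type*) where
  /-- the dimension of the reference system `R_k` -/
  refDim : ℕ → ℕ
  /-- the initial state -/
  init : Matrix (Fin (refDim 0) × B) (Fin (refDim 0) × B) ℂ
  init_isDensity : IsDensity init
  /-- the operation after the use number `k` (counted from `0`) of the unknown channel -/
  step : ∀ k, Matrix (Fin (refDim k) × B') (Fin (refDim k) × B') ℂ →ₗ[ℂ]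
    Matrix (Fin (refDim (k + 1)) × B) (Fin (refDim (k + 1)) × B) ℂ
  step_isQuantumChannel : ∀ k, IsQuantumChannel (step k)
  /-- the number of measurement outcomes -/
  numOutcomes : ℕ
  /-- the POVM -/
  povm : Fin numOutcomes → Matrix (Fin (refDim N) × B) (Fin (refDim N) × B) ℂ
  povm_posSemidef : ∀ o, (povm o).PosSemidef
  povm_sum : ∑ o, povm o = 1
  /-- the estimate computed from the outcome -/
  estimate : Fin numOutcomes → V

namespace EstimationProtocol

variable {B B' : Type} [Fintype B] [Fintype B'] [DecidableEq B] {N : ℕ} {V : Type*}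

/-- The state after `k` uses of the unknown channel `Φ`. -/
def state (P : EstimationProtocol B B' N V) (Φ : Matrix B B ℂ →ₗ[ℂ] Matrix B' B' ℂ) :
    ∀ k, Matrix (Fin (P.refDim k) × B) (Fin (P.refDim k) × B) ℂ
  | 0 => P.init
  | k + 1 => P.step k (tensorId Φ (P.state Φ k))

/-- The probability of the outcome `o` if the unknown channel is `Φ`. -/
noncomputable def prob (P : EstimationProtocol B B' N V)
    (Φ : Matrix B B ℂ →ₗ[ℂ] Matrix B' B' ℂ) (o : Fin P.numOutcomes) : ℝ :=
  (P.state Φ N * P.povm o).trace.re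

/-- The root mean squared error of the estimate if the unknown channel is `Φ` and the true value of
the estimated quantity is `v`. -/
noncomputable def rmse [NormedAddCommGroup V] (P : EstimationProtocol B B' N V)
    (Φ : Matrix B B ℂ →ₗ[ℂ] Matrix B' B' ℂ) (v : V) : ℝ :=
  √(∑ o, P.prob Φ o * ‖P.estimate o - v‖ ^ 2)

end EstimationProtocol

/-!
The dependence of a discrete memoryless channel `Q` on its transition matrix can be moved into a
random function: draw `f : Fin m → Fin n` with probability `∏ₓ q_{x f(x)}` (`functionProb`) and
answer the input letter `x` by `f(x)`. The value at `x` has distribution `q_{x ·}`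
(`sum_functionProb_ite`).

*Programming.* The program ket is the superposition of all functions `f`, with these probabilities
as squared amplitudes. The gates write `f(x)` into a new register, so that the partial trace leaves
`𝒬(σ)`: `exists_unitary_programmable`, where the blank register makes the gate a permutation of the
basis, and `exists_channel_programmable`, where the gate is an isometry.

*Estimation.* Since `𝒬` is a mixture of noiseless channels, with weights that carry all the
dependence on `Q` (`dmcChannel_eq_sum_deterministic`), the final state of a protocol with `N` uses
is a mixture of fixed states, indexed by `N` independent random functions
(`EstimationProtocol.exists_state_eq_sum`). Hence, whatever quantum operations are used, the outcome
distribution is a classical post-processing of a sample of size `N`, and for two channels the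
Bhattacharyya coefficient of the outcome distributions is at least `F ^ N`, where
`F = ∏ₓ ∑_y √(q_{xy} q'_{xy})`. If the `√q_{xy}` differ by at most `d`, then `F ^ N ≥ 1 - O(N d²)`,
and Le Cam's two-point argument bounds the sum of the errors from below by the distance of the two
true values (`EstimationProtocol.norm_sub_le_two_mul_rmse_add`).

It remains to find a curve of parameters along which `τ` moves with positive speed and all
`√q_{xy}` are Lipschitz. The first comes from a segment in a chart at a point where the derivative
of `τ` does not vanish (`exists_curve_expanding`). The second may fail at the zeros of `q_{xy}` (it
does at boundary points of the family, where estimation can be faster), and the entries are only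
differentiable; but a differentiable function on an interval has no zeros on some subinterval or
vanishes identically, and by the Baire category theorem it is Lipschitz on some subinterval
(`exists_Ioo_sqrt_lipschitz`). This gives a two-point bound with uniform constants
(`exists_curve_two_point_bound`). Two points at distance of order `1/√N` yield the uniform bound,
and a second use of the Baire category theorem excludes a rate `o(1/√N)` at all points
(`not_forall_rmse_isLittleO`).
-/

/-! ### Quantum channels -/

section Channels

variable {ι κ α : Type*} [Fintype ι] [Fintype κ] [Fintype α]

/-- A superoperator in Kraus form `X ↦ ∑ₐ Kₐ X Kₐ†` with `∑ₐ Kₐ† Kₐ = 1` is a quantum channel. -/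
theorem isQuantumChannel_of_kraus [DecidableEq ι] (Φ : Matrix ι ι ℂ →ₗ[ℂ] Matrix κ κ ℂ)
    (K : α → Matrix κ ι ℂ) (hΦ : ∀ X, Φ X = ∑ a, K a * X * (K a).conjTranspose)
    (hK : ∑ a, (K a).conjTranspose * K a = 1) : IsQuantumChannel Φ := by
  refine ⟨fun r X hX => ?_, fun X => ?_⟩
  · have h : tensorId Φ X = ∑ a, ((1 : Matrix (Fin r) (Fin r) ℂ) ⊗ₖ K a) * X *
        ((1 : Matrix (Fin r) (Fin r) ℂ) ⊗ₖ K a).conjTranspose := by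
      ext ⟨p, i⟩ ⟨q, j⟩
      simp [tensorId, hΦ, Matrix.sum_apply, Matrix.mul_apply, Fintype.sum_prod_type,
        Matrix.kroneckerMap_apply, Matrix.one_apply, ite_mul, Finset.sum_mul,
        apply_ite (starRingEnd ℂ)]
    rw [h]
    exact Matrix.posSemidef_sum _ fun a _ => hX.mul_mul_conjTranspose_same _
  · rw [hΦ, Matrix.trace_sum]
    calc ∑ a, (K a * X * (K a).conjTranspose).trace
        = ∑ a, ((K a).conjTranspose * K a * X).trace := by
          refine Finset.sum_congr rfl fun a _ => ?_
          rw [Matrix.trace_mul_comm, Matrix.mul_assoc]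
      _ = X.trace := by
          rw [← Matrix.trace_sum, ← Finset.sum_mul, hK, Matrix.one_mul]

theorem isQuantumChannel_conjBy [DecidableEq ι] {U : Matrix κ ι ℂ}
    (hU : U.conjTranspose * U = 1) : IsQuantumChannel (conjBy U) :=
  isQuantumChannel_of_kraus _ (fun _ : Unit => U) (fun X => by simp [conjBy]) (by simpa using hU)

theorem IsQuantumChannel.posSemidef {Φ : Matrix ι ι ℂ →ₗ[ℂ] Matrix κ κ ℂ}
    (hΦ : IsQuantumChannel Φ) {X : Matrix ι ι ℂ} (hX : X.PosSemidef) : (Φ X).PosSemidef := by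
  have h := (hΦ.1 1 (X.submatrix Prod.snd Prod.snd) (hX.submatrix _)).submatrix
    (fun k : κ => ((0 : Fin 1), k))
  exact h

theorem IsQuantumChannel.isDensity {Φ : Matrix ι ι ℂ →ₗ[ℂ] Matrix κ κ ℂ}
    (hΦ : IsQuantumChannel Φ) {X : Matrix ι ι ℂ} (hX : IsDensity X) : IsDensity (Φ X) :=
  ⟨hΦ.posSemidef hX.1, (hΦ.2 X).trans hX.2⟩

theorem IsQuantumChannel.isDensity_tensorId {Φ : Matrix ι ι ℂ →ₗ[ℂ] Matrix κ κ ℂ}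
    (hΦ : IsQuantumChannel Φ) {r : ℕ} {X : Matrix (Fin r × ι) (Fin r × ι) ℂ}
    (hX : IsDensity X) : IsDensity (tensorId Φ X) := by
  refine ⟨hΦ.1 r X hX.1, ?_⟩
  rw [← hX.2]
  have h := fun p => hΦ.2 (Matrix.of fun i j => X (p, i) (p, j))
  simp only [Matrix.trace, Matrix.diag] at h ⊢
  simp only [tensorId, Matrix.of_apply, Fintype.sum_prod_type] at h ⊢
  exact Finset.sum_congr rfl fun p _ => h p

theorem isDensity_pureState {ψ : ι → ℂ} (h : ∑ i, ψ i * star (ψ i) = 1) :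
    IsDensity (pureState ψ) :=
  ⟨Matrix.posSemidef_vecMulVec_self_star ψ, by
    simpa [Matrix.trace, pureState, Matrix.vecMulVec_apply] using h⟩

open scoped MatrixOrder Matrix.Norms.L2Operator in
/-- Born probabilities are nonnegative. -/
theorem trace_mul_re_nonneg {A B : Matrix ι ι ℂ} (hA : A.PosSemidef) (hB : B.PosSemidef) :
    0 ≤ (A * B).trace.re := by
  classical
  obtain ⟨C, rfl⟩ := CStarAlgebra.nonneg_iff_eq_star_mul_self.1 hB.nonneg
  rw [← Matrix.mul_assoc, Matrix.trace_mul_comm, ← Matrix.mul_assoc]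
  exact (Complex.le_def.1 (hA.mul_mul_conjTranspose_same C).trace_nonneg).1

end Channels

/-! ### Programming memoryless channels -/

section Programming

variable {m n : ℕ}

/-- The probability `∏ₓ q_{x f(x)}` of the function `f` if the values `f(x)` are drawn
independently, `f(x)` from row `x` of the matrix. -/
def functionProb (Q : Matrix (Fin m) (Fin n) ℝ) (f : Fin m → Fin n) : ℝ :=
  ∏ x, Q x (f x)

theorem functionProb_nonneg (Q : StochasticMatrix m n) (f : Fin m → Fin n) :
    0 ≤ functionProb Q.1 f :=
  Finset.prod_nonneg fun x _ => Q.2.1 x (f x)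

theorem sum_functionProb (Q : StochasticMatrix m n) : ∑ f, functionProb Q.1 f = 1 := by
  have h := Finset.prod_univ_sum (fun _ : Fin m => (Finset.univ : Finset (Fin n)))
    (fun x y => Q.1 x y)
  simp only [Q.2.2, Finset.prod_const_one, Fintype.piFinset_univ] at h
  exact h.symm

/-- The value of the random function at `x` is distributed according to row `x`. -/
theorem sum_functionProb_ite (Q : StochasticMatrix m n) (x : Fin m) (y : Fin n) :
    ∑ f, (if f x = y then functionProb Q.1 f else 0) = Q.1 x y := by
  have h := Finset.prod_univ_sum (fun _ : Fin m => (Finset.univ : Finset (Fin n)))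
    (fun x' y' => if x' = x then (if y' = y then Q.1 x' y' else 0) else Q.1 x' y')
  rw [Fintype.piFinset_univ, Finset.prod_eq_single x] at h
  · simp only [if_true, Finset.sum_ite_eq', Finset.mem_univ] at h
    rw [h]
    refine Finset.sum_congr rfl fun f _ => ?_
    split_ifs with hf
    · refine Finset.prod_congr rfl fun x' _ => ?_
      by_cases hx : x' = x
      · subst hx; simp [hf]
      · simp [hx]
    · exact (Finset.prod_eq_zero (Finset.mem_univ x) (by simp [hf])).symm
  · intro x' _ hx
    simp [hx, Q.2.2]
  · simp

theorem programKet_apply (Q : StochasticMatrix m n) (f : Fin m → Fin n) :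
    programKet Q f = ((∏ x, √(Q.1 x (f x)) : ℝ) : ℂ) := by
  simp [programKet, tensorKet, Finset.sum_apply, Pi.single_apply]

theorem programKet_mul_star (Q : StochasticMatrix m n) (f : Fin m → Fin n) :
    programKet Q f * star (programKet Q f) = (functionProb Q.1 f : ℂ) := by
  rw [programKet_apply, Complex.star_def, Complex.conj_ofReal, ← Complex.ofReal_mul,
    ← Finset.prod_mul_distrib]
  simp only [Real.mul_self_sqrt (Q.2.1 _ _), functionProb]

/-- The Kraus operators are `√q_{xy} |y⟩⟨x|`. -/
theorem isQuantumChannel_dmcChannel (Q : StochasticMatrix m n) :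
    IsQuantumChannel (dmcChannel Q) := by
  have hq : ∀ x y, ((√(Q.1 x y) : ℝ) : ℂ) * ((√(Q.1 x y) : ℝ) : ℂ) = (Q.1 x y : ℂ) := fun x y => by
    rw [← Complex.ofReal_mul, Real.mul_self_sqrt (Q.2.1 x y)]
  refine isQuantumChannel_of_kraus _
    (fun a : Fin m × Fin n => Matrix.single a.2 a.1 ((√(Q.1 a.1 a.2) : ℝ) : ℂ)) (fun X => ?_) ?_
  · ext y y'
    simp only [Fintype.sum_prod_type, Matrix.sum_apply, Matrix.conjTranspose_single,
      Matrix.single_mul_mul_single, dmcChannel, LinearMap.coe_mk, AddHom.coe_mk,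
      Matrix.diagonal_apply, Matrix.single_apply, Complex.star_def, Complex.conj_ofReal]
    by_cases h : y = y'
    · subst h
      simp only [if_true, and_self, Finset.sum_ite_eq', Finset.mem_univ]
      refine Finset.sum_congr rfl fun x _ => ?_
      rw [mul_right_comm, hq, mul_comm]
    · rw [if_neg h]
      refine (Finset.sum_eq_zero fun x _ => Finset.sum_eq_zero fun z _ => if_neg ?_).symm
      rintro ⟨rfl, rfl⟩
      exact h rfl
  · ext x x'
    simp only [Fintype.sum_prod_type, Matrix.sum_apply, Matrix.conjTranspose_single,
      Matrix.single_mul_single_same, Complex.star_def, Complex.conj_ofReal, hq,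
      Matrix.single_apply, Matrix.one_apply]
    by_cases h : x = x'
    · subst h
      simp only [and_self, if_true]
      rw [Finset.sum_comm]
      simp only [Finset.sum_ite_eq', Finset.mem_univ, if_true]
      rw [← Complex.ofReal_sum, Q.2.2, Complex.ofReal_one]
    · rw [if_neg h]
      refine Finset.sum_eq_zero fun z _ => Finset.sum_eq_zero fun y _ => if_neg ?_
      rintro ⟨rfl, rfl⟩
      exact h rfl

theorem dmcChannel_apply (Q : StochasticMatrix m n) (σ : Matrix (Fin m) (Fin m) ℂ) (y y' : Fin n) :
    dmcChannel Q σ y y' = if y = y' then ∑ x, σ x x * (Q.1 x y : ℂ) else 0 := by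
  simp [dmcChannel, Matrix.diagonal_apply]

/-- Reading the value at the input letter off a random function simulates the channel. -/
theorem dmcChannel_apply_eq_sum_functionProb (Q : StochasticMatrix m n)
    (σ : Matrix (Fin m) (Fin m) ℂ) (y y' : Fin n) :
    dmcChannel Q σ y y' =
      ∑ f : Fin m → Fin n, ∑ x, if f x = y ∧ f x = y' then (functionProb Q.1 f : ℂ) * σ x x
        else 0 := by
  rw [dmcChannel_apply, Finset.sum_comm]
  split_ifs with h
  · subst h
    refine Finset.sum_congr rfl fun x _ => ?_
    rw [← sum_functionProb_ite Q x y, Complex.ofReal_sum, Finset.mul_sum]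
    refine Finset.sum_congr rfl fun f _ => ?_
    by_cases hf : f x = y <;> simp [hf, mul_comm]
  · refine (Finset.sum_eq_zero fun x _ => Finset.sum_eq_zero fun f _ => if_neg ?_).symm
    rintro ⟨h1, h2⟩
    exact h (h1.symm.trans h2)

/-- The unitary gate is the permutation `|f⟩|b⟩|x⟩ ↦ |f⟩|x⟩|f(x) + b⟩` of basis vectors. -/
theorem exists_unitary_programmable (m n : ℕ) [NeZero m] [NeZero n] :
    ∃ U : Matrix (((Fin m → Fin n) × Fin m) × Fin n) (((Fin m → Fin n) × Fin n) × Fin m) ℂ,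
      U.conjTranspose * U = 1 ∧ U * U.conjTranspose = 1 ∧
      IsProgrammableBy (fun Q : StochasticMatrix m n => dmcChannel Q)
        (fun Q => pureState (programKetBlank Q)) (conjBy U) := by
  classical
  let e : (((Fin m → Fin n) × Fin m) × Fin n) ≃ (((Fin m → Fin n) × Fin n) × Fin m) :=
    { toFun := fun p => ((p.1.1, p.2 - p.1.1 p.1.2), p.1.2)
      invFun := fun p => ((p.1.1, p.2), p.1.2 + p.1.1 p.2)
      left_inv := fun p => by simp
      right_inv := fun p => by simp }
  let U : Matrix (((Fin m → Fin n) × Fin m) × Fin n) (((Fin m → Fin n) × Fin n) × Fin m) ℂ :=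
    (1 : Matrix _ _ ℂ).submatrix e id
  have hUU : U.conjTranspose * U = 1 := by
    simp only [U, Matrix.conjTranspose_submatrix, Matrix.conjTranspose_one]
    rw [Matrix.submatrix_mul_equiv, Matrix.one_mul, Matrix.submatrix_id_id]
  refine ⟨U, hUU, ?_, isQuantumChannel_dmcChannel, fun Q => ?_, isQuantumChannel_conjBy hUU,
    fun Q σ _ => ?_⟩
  · simp only [U, Matrix.conjTranspose_submatrix, Matrix.conjTranspose_one]
    have h := Matrix.submatrix_mul_equiv (1 : Matrix (((Fin m → Fin n) × Fin n) × Fin m) _ ℂ)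
      (1 : Matrix (((Fin m → Fin n) × Fin n) × Fin m) _ ℂ) e (Equiv.refl _) e
    rw [Equiv.coe_refl] at h
    rw [h, Matrix.one_mul, Matrix.submatrix_one_equiv]
  · refine isDensity_pureState ?_
    simp only [Fintype.sum_prod_type, programKetBlank, star_mul', Pi.single_apply]
    have h0 : ∀ f : Fin m → Fin n, (∑ b : Fin n, programKet Q f * (if b = 0 then 1 else 0) *
        (star (programKet Q f) * star (if b = 0 then 1 else 0))) = (functionProb Q.1 f : ℂ) := by
      intro f
      rw [Finset.sum_eq_single 0 (fun b _ hb => by simp [hb]) (by simp)]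
      simpa using programKet_mul_star Q f
    simp only [h0]
    rw [← Complex.ofReal_sum, sum_functionProb, Complex.ofReal_one]
  · have hU : ∀ X, conjBy U X = X.submatrix e e := by
      intro X
      ext p q
      simp [conjBy, U, Matrix.mul_apply, Matrix.one_apply]
    ext y y'
    rw [dmcChannel_apply_eq_sum_functionProb, hU]
    simp only [traceFst, Matrix.of_apply, Matrix.submatrix_apply, Fintype.sum_prod_type,
      Matrix.kroneckerMap_apply, pureState, Matrix.vecMulVec_apply, Pi.star_apply,
      programKetBlank, star_mul', e, Equiv.coe_fn_mk]
    refine Finset.sum_congr rfl fun f _ => Finset.sum_congr rfl fun x _ => ?_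
    rw [← programKet_mul_star]
    simp only [Pi.single_apply, sub_eq_zero, eq_comm (a := f x)]
    by_cases h1 : y = f x <;> by_cases h2 : y' = f x <;> simp [h1, h2]

/-- The gate is the isometry `|f⟩|x⟩ ↦ |f⟩|x⟩|f(x)⟩`. -/
theorem exists_channel_programmable (m n : ℕ) :
    ∃ G : Matrix ((Fin m → Fin n) × Fin m) ((Fin m → Fin n) × Fin m) ℂ →ₗ[ℂ]
        Matrix (((Fin m → Fin n) × Fin m) × Fin n) (((Fin m → Fin n) × Fin m) × Fin n) ℂ,
      IsProgrammableBy (fun Q : StochasticMatrix m n => dmcChannel Q)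
        (fun Q => pureState (programKet Q)) G := by
  classical
  let W : Matrix (((Fin m → Fin n) × Fin m) × Fin n) ((Fin m → Fin n) × Fin m) ℂ :=
    Matrix.of fun p q => if p.1 = q ∧ q.1 q.2 = p.2 then 1 else 0
  have hW : W.conjTranspose * W = 1 := by
    ext p q
    simp only [Matrix.mul_apply, Matrix.conjTranspose_apply, W, Matrix.of_apply, Matrix.one_apply]
    rw [Fintype.sum_prod_type, Finset.sum_eq_single p (fun b _ hb => by simp [hb]) (by simp),
      Finset.sum_eq_single (p.1 p.2) (fun b _ hb => by simp [hb.symm]) (by simp)]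
    by_cases h : p = q
    · subst h; simp
    · simp [h]
  refine ⟨conjBy W, isQuantumChannel_dmcChannel, fun Q => ?_, isQuantumChannel_conjBy hW,
    fun Q σ _ => ?_⟩
  · refine isDensity_pureState ?_
    simp only [programKet_mul_star]
    rw [← Complex.ofReal_sum, sum_functionProb, Complex.ofReal_one]
  · have hWX : ∀ X p q, conjBy W X p q =
        if p.1.1 p.1.2 = p.2 ∧ q.1.1 q.1.2 = q.2 then X p.1 q.1 else 0 := by
      intro X p q
      simp only [conjBy, LinearMap.coe_mk, AddHom.coe_mk, Matrix.mul_apply,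
        Matrix.conjTranspose_apply, W, Matrix.of_apply]
      rw [Finset.sum_eq_single q.1 (fun b _ hb => by simp [hb.symm]) (by simp),
        Finset.sum_eq_single p.1 (fun b _ hb => by simp [hb.symm]) (by simp)]
      by_cases h1 : p.1.1 p.1.2 = p.2 <;> by_cases h2 : q.1.1 q.1.2 = q.2 <;> simp [h1, h2]
    ext y y'
    rw [dmcChannel_apply_eq_sum_functionProb]
    simp only [traceFst, Matrix.of_apply, hWX, Fintype.sum_prod_type,
      Matrix.kroneckerMap_apply, pureState, Matrix.vecMulVec_apply, Pi.star_apply,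
      programKet_mul_star]

end Programming

/-! ### Simulation by random functions -/

section Simulation

variable {m n : ℕ}

/-- The noiseless channel that replaces the letter `x` by `f(x)`. -/
def deterministicMatrix (f : Fin m → Fin n) : StochasticMatrix m n :=
  ⟨Matrix.of fun x y => if f x = y then 1 else 0,
    fun x y => by simp only [Matrix.of_apply]; split_ifs <;> norm_num, fun x => by simp⟩

/-- A memoryless channel is a mixture of noiseless channels, with weights that carry all the
dependence on the channel. -/
theorem dmcChannel_eq_sum_deterministic (Q : StochasticMatrix m n) :
    dmcChannel Q = ∑ f, (functionProb Q.1 f : ℂ) • dmcChannel (deterministicMatrix f) := by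
  refine LinearMap.ext fun σ => ?_
  ext y y'
  rw [dmcChannel_apply_eq_sum_functionProb, LinearMap.sum_apply, Matrix.sum_apply]
  refine Finset.sum_congr rfl fun f _ => ?_
  rw [LinearMap.smul_apply, Matrix.smul_apply, dmcChannel_apply, smul_eq_mul]
  split_ifs with h
  · subst h
    rw [Finset.mul_sum]
    refine Finset.sum_congr rfl fun x _ => ?_
    by_cases hf : f x = y <;> simp [deterministicMatrix, hf]
  · rw [mul_zero]
    refine Finset.sum_eq_zero fun x _ => if_neg ?_
    rintro ⟨h1, h2⟩
    exact h (h1.symm.trans h2)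

theorem tensorId_sum_smul {ι κ α γ : Type*} [Fintype ι] [Fintype κ] [Fintype α] [Fintype γ]
    {R : Type*} (c : α → ℂ) (Φ : α → Matrix ι ι ℂ →ₗ[ℂ] Matrix κ κ ℂ) (w : γ → ℂ)
    (S : γ → Matrix (R × ι) (R × ι) ℂ) :
    tensorId (∑ a, c a • Φ a) (∑ j, w j • S j) =
      ∑ i : γ × α, (w i.1 * c i.2) • tensorId (Φ i.2) (S i.1) := by
  ext ⟨p, k⟩ ⟨q, l⟩
  have h : (Matrix.of fun i j => (∑ a, w a • S a) (p, i) (q, j)) =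
      ∑ a, w a • (Matrix.of fun i j => S a (p, i) (q, j) : Matrix ι ι ℂ) := by
    ext i j
    simp [Matrix.sum_apply]
  change (∑ a, c a • Φ a) (Matrix.of fun i j => (∑ a, w a • S a) (p, i) (q, j)) k l = _
  rw [h]
  unfold tensorId
  simp only [Matrix.of_apply, Matrix.sum_apply, Matrix.smul_apply, map_sum, map_smul,
    LinearMap.sum_apply, LinearMap.smul_apply, Fintype.sum_prod_type, smul_eq_mul,
    Finset.mul_sum, mul_assoc]

/-- The Bhattacharyya coefficient of the random functions that represent two memoryless
channels. -/
noncomputable def bhattacharyya (Q Q' : StochasticMatrix m n) : ℝ :=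
  ∑ f, √(functionProb Q.1 f) * √(functionProb Q'.1 f)

theorem bhattacharyya_eq_prod (Q Q' : StochasticMatrix m n) :
    bhattacharyya Q Q' = ∏ x, ∑ y, √(Q.1 x y) * √(Q'.1 x y) := by
  rw [Finset.prod_univ_sum, Fintype.piFinset_univ]
  refine Finset.sum_congr rfl fun f _ => ?_
  rw [functionProb, functionProb, Real.sqrt_prod _ fun x _ => Q.2.1 x _,
    Real.sqrt_prod _ fun x _ => Q'.2.1 x _, Finset.prod_mul_distrib]

theorem bhattacharyya_self (Q : StochasticMatrix m n) : bhattacharyya Q Q = 1 := by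
  refine Eq.trans (Finset.sum_congr rfl fun f _ => ?_) (sum_functionProb Q)
  exact Real.mul_self_sqrt (functionProb_nonneg Q f)

/-- If the square roots of the transition probabilities differ by at most `d`, then `N` uses of
the channels have Bhattacharyya coefficient `1 - O(N d²)`. -/
theorem one_sub_le_bhattacharyya_pow {Q Q' : StochasticMatrix m n} {d : ℝ}
    (hd : ∀ x y, |√(Q.1 x y) - √(Q'.1 x y)| ≤ d) (hd2 : n * d ^ 2 ≤ 2) (N : ℕ) :
    1 - (N * m * n : ℝ) * d ^ 2 / 2 ≤ bhattacharyya Q Q' ^ N := by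
  have hx : ∀ x, 1 - n * d ^ 2 / 2 ≤ ∑ y, √(Q.1 x y) * √(Q'.1 x y) := by
    intro x
    have h1 : ∀ y, √(Q.1 x y) * √(Q'.1 x y) =
        (Q.1 x y + Q'.1 x y - (√(Q.1 x y) - √(Q'.1 x y)) ^ 2) / 2 := by
      intro y
      have h2 := Real.sq_sqrt (Q.2.1 x y)
      have h3 := Real.sq_sqrt (Q'.2.1 x y)
      nlinarith
    have h4 : ∑ y, (√(Q.1 x y) - √(Q'.1 x y)) ^ 2 ≤ n * d ^ 2 := by
      calc _ ≤ ∑ _y : Fin n, d ^ 2 := Finset.sum_le_sum fun y _ => by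
            rw [← sq_abs]
            exact pow_le_pow_left₀ (abs_nonneg _) (hd x y) 2
        _ = n * d ^ 2 := by simp
    simp only [h1]
    rw [← Finset.sum_div, Finset.sum_sub_distrib, Finset.sum_add_distrib, Q.2.2, Q'.2.2]
    linarith
  have h0 : 0 ≤ 1 - n * d ^ 2 / 2 := by linarith
  have hF : (1 - n * d ^ 2 / 2) ^ m ≤ bhattacharyya Q Q' := by
    rw [bhattacharyya_eq_prod]
    calc (1 - n * d ^ 2 / 2) ^ m = ∏ _x : Fin m, (1 - n * d ^ 2 / 2) := by simp
      _ ≤ _ := Finset.prod_le_prod (fun _ _ => h0) fun x _ => hx x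
  calc 1 - (N * m * n : ℝ) * d ^ 2 / 2 = 1 + ((m * N : ℕ) : ℝ) * (-(n * d ^ 2 / 2)) := by
        push_cast; ring
    _ ≤ (1 + -(n * d ^ 2 / 2)) ^ (m * N) := one_add_mul_le_pow (by linarith) _
    _ = ((1 - n * d ^ 2 / 2) ^ m) ^ N := by rw [← sub_eq_add_neg, pow_mul]
    _ ≤ bhattacharyya Q Q' ^ N := pow_le_pow_left₀ (pow_nonneg h0 _) hF _

end Simulation

/-! ### Two-point bounds for estimation protocols -/

namespace EstimationProtocol

variable {m n N : ℕ} {V : Type*}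

/-- After `k` uses of the channel, the state is a mixture of states that do not depend on the
channel, indexed by the values of `k` independent random functions. -/
theorem exists_state_eq_sum (P : EstimationProtocol (Fin m) (Fin n) N V) (k : ℕ) :
    ∃ (J : Type) (_ : Fintype J) (w : StochasticMatrix m n → J → ℝ)
      (S : J → Matrix (Fin (P.refDim k) × Fin m) (Fin (P.refDim k) × Fin m) ℂ),
      (∀ Q j, 0 ≤ w Q j) ∧ (∀ j, IsDensity (S j)) ∧
      (∀ Q, P.state (dmcChannel Q) k = ∑ j, (w Q j : ℂ) • S j) ∧
      ∀ Q Q', ∑ j, √(w Q j) * √(w Q' j) = bhattacharyya Q Q' ^ k := by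
  induction k with
  | zero =>
    exact ⟨Unit, inferInstance, fun _ _ => 1, fun _ => P.init, fun _ _ => zero_le_one,
      fun _ => P.init_isDensity, fun Q => by simp [state], fun Q Q' => by simp⟩
  | succ k ih =>
    obtain ⟨J, _, w, S, hw, hS, hstate, hF⟩ := ih
    refine ⟨J × (Fin m → Fin n), inferInstance, fun Q i => w Q i.1 * functionProb Q.1 i.2,
      fun i => P.step k (tensorId (dmcChannel (deterministicMatrix i.2)) (S i.1)),
      fun Q i => mul_nonneg (hw Q _) (functionProb_nonneg Q _), fun i => ?_, fun Q => ?_,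
      fun Q Q' => ?_⟩
    · exact (P.step_isQuantumChannel k).isDensity
        ((isQuantumChannel_dmcChannel _).isDensity_tensorId (hS _))
    · rw [state, hstate, dmcChannel_eq_sum_deterministic Q, tensorId_sum_smul, map_sum]
      refine Finset.sum_congr rfl fun i _ => ?_
      rw [map_smul, Complex.ofReal_mul]
    · rw [pow_succ, ← hF, bhattacharyya, Finset.sum_mul_sum, Fintype.sum_prod_type]
      refine Finset.sum_congr rfl fun j _ => Finset.sum_congr rfl fun f _ => ?_
      rw [Real.sqrt_mul (hw Q j), Real.sqrt_mul (hw Q' j)]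
      ring

/-- Quantum processing between the uses does not help to distinguish two memoryless channels: the
outcome distributions have Bhattacharyya coefficient at least the `N`-th power of the coefficient
of the random functions. -/
theorem bhattacharyya_pow_le (P : EstimationProtocol (Fin m) (Fin n) N V) :
    (∀ Q o, 0 ≤ P.prob (dmcChannel Q) o) ∧ (∀ Q, ∑ o, P.prob (dmcChannel Q) o = 1) ∧
    ∀ Q Q', bhattacharyya Q Q' ^ N ≤
      ∑ o, √(P.prob (dmcChannel Q) o) * √(P.prob (dmcChannel Q') o) := by
  obtain ⟨J, _, w, S, hw, hS, hstate, hF⟩ := P.exists_state_eq_sum N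
  -- the conditional outcome distributions, given the values of the random functions
  set W : J → Fin P.numOutcomes → ℝ := fun j o => (S j * P.povm o).trace.re with hWdef
  have hW : ∀ j o, 0 ≤ W j o := fun j o => trace_mul_re_nonneg (hS j).1 (P.povm_posSemidef o)
  have hW1 : ∀ j, ∑ o, W j o = 1 := by
    intro j
    rw [hWdef, ← Complex.re_sum, ← Matrix.trace_sum, ← Finset.mul_sum, P.povm_sum, Matrix.mul_one,
      (hS j).2, Complex.one_re]
  have hp : ∀ Q o, P.prob (dmcChannel Q) o = ∑ j, w Q j * W j o := by
    intro Q o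
    simp [prob, hstate, Finset.sum_mul, Matrix.trace_sum, hWdef]
  refine ⟨fun Q o => ?_, fun Q => ?_, fun Q Q' => ?_⟩
  · rw [hp]
    exact Finset.sum_nonneg fun j _ => mul_nonneg (hw Q j) (hW j o)
  · have h := hF Q Q
    simp only [Real.mul_self_sqrt (hw Q _), bhattacharyya_self, one_pow] at h
    simp only [hp]
    rw [Finset.sum_comm]
    simp only [← Finset.mul_sum, hW1, mul_one, h]
  · calc bhattacharyya Q Q' ^ N = ∑ j, √(w Q j) * √(w Q' j) * ∑ o, W j o := by
          simp only [hW1, mul_one, hF]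
      _ = ∑ o, ∑ j, √(w Q j * W j o) * √(w Q' j * W j o) := by
          simp only [Finset.mul_sum]
          rw [Finset.sum_comm]
          refine Finset.sum_congr rfl fun o _ => Finset.sum_congr rfl fun j _ => ?_
          rw [Real.sqrt_mul (hw Q j), Real.sqrt_mul (hw Q' j), mul_mul_mul_comm,
            Real.mul_self_sqrt (hW j o)]
      _ ≤ _ := Finset.sum_le_sum fun o _ => by
          rw [hp, hp]
          exact Real.sum_sqrt_mul_sqrt_le _ (fun j => mul_nonneg (hw Q j) (hW j o))
            fun j => mul_nonneg (hw Q' j) (hW j o)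

theorem rmse_nonneg [NormedAddCommGroup V] (P : EstimationProtocol (Fin m) (Fin n) N V)
    (Φ : Matrix (Fin m) (Fin m) ℂ →ₗ[ℂ] Matrix (Fin n) (Fin n) ℂ) (v : V) : 0 ≤ P.rmse Φ v :=
  Real.sqrt_nonneg _

/-- Le Cam's two-point bound: the distance of the true values, weighted by the overlap of the
outcome distributions, is at most the sum of the errors. This is the triangle inequality for each
outcome followed by the Cauchy-Schwarz inequality. -/
theorem norm_sub_mul_bhattacharyya_le [NormedAddCommGroup V]
    (P : EstimationProtocol (Fin m) (Fin n) N V) (Q Q' : StochasticMatrix m n) (v v' : V) :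
    ‖v - v'‖ * bhattacharyya Q Q' ^ N ≤ P.rmse (dmcChannel Q) v + P.rmse (dmcChannel Q') v' := by
  obtain ⟨h0, h1, hF⟩ := P.bhattacharyya_pow_le
  set p := P.prob (dmcChannel Q) with hp
  set p' := P.prob (dmcChannel Q') with hp'
  have key : ∀ (r r' : Fin P.numOutcomes → ℝ) (u : V), (∀ o, 0 ≤ r o) → (∀ o, 0 ≤ r' o) →
      ∑ o, r' o = 1 → ∑ o, √(r o) * √(r' o) * ‖P.estimate o - u‖ ≤
        √(∑ o, r o * ‖P.estimate o - u‖ ^ 2) := by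
    intro r r' u hr hr' hr1
    have h := Real.sum_sqrt_mul_sqrt_le Finset.univ
      (fun o => mul_nonneg (hr o) (sq_nonneg ‖P.estimate o - u‖)) hr'
    rw [hr1, Real.sqrt_one, mul_one] at h
    refine le_trans (le_of_eq (Finset.sum_congr rfl fun o _ => ?_)) h
    rw [Real.sqrt_mul (hr o), Real.sqrt_sq (norm_nonneg _)]
    ring
  calc ‖v - v'‖ * bhattacharyya Q Q' ^ N ≤ ‖v - v'‖ * ∑ o, √(p o) * √(p' o) :=
        mul_le_mul_of_nonneg_left (hF Q Q') (norm_nonneg _)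
    _ ≤ ∑ o, (√(p o) * √(p' o) * ‖P.estimate o - v‖ + √(p' o) * √(p o) * ‖P.estimate o - v'‖) := by
        rw [Finset.mul_sum]
        refine Finset.sum_le_sum fun o _ => ?_
        have h : ‖v - v'‖ ≤ ‖P.estimate o - v‖ + ‖P.estimate o - v'‖ := by
          rw [norm_sub_rev (P.estimate o) v]
          exact norm_sub_le_norm_sub_add_norm_sub _ _ _
        calc _ ≤ (‖P.estimate o - v‖ + ‖P.estimate o - v'‖) * (√(p o) * √(p' o)) :=
              mul_le_mul_of_nonneg_right h (by positivity)
          _ = _ := by ring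
    _ ≤ _ := by
        rw [Finset.sum_add_distrib]
        exact add_le_add (key p p' v (h0 Q) (h0 Q') (h1 Q')) (key p' p v' (h0 Q') (h0 Q) (h1 Q))

/-- Two channels at distance `O(1/√N)` in the square roots of the transition probabilities are not
separated by `N` uses. -/
theorem norm_sub_le_two_mul_rmse_add [NormedAddCommGroup V] [NeZero m]
    (P : EstimationProtocol (Fin m) (Fin n) N V) {Q Q' : StochasticMatrix m n} {d : ℝ}
    (hd : ∀ x y, |√(Q.1 x y) - √(Q'.1 x y)| ≤ d) (hN : 1 ≤ N) (hNd : (N * m * n : ℝ) * d ^ 2 ≤ 1)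
    (v v' : V) :
    ‖v - v'‖ ≤ 2 * (P.rmse (dmcChannel Q) v + P.rmse (dmcChannel Q') v') := by
  have hm : (1 : ℝ) ≤ N * m := by
    exact_mod_cast Nat.mul_pos hN (Nat.pos_of_ne_zero (NeZero.ne m))
  have hn : (n : ℝ) * d ^ 2 ≤ N * m * n * d ^ 2 := by
    have h := mul_le_mul_of_nonneg_right hm (by positivity : (0 : ℝ) ≤ n * d ^ 2)
    linarith
  have h := one_sub_le_bhattacharyya_pow hd (by linarith) N
  have h2 := P.norm_sub_mul_bhattacharyya_le Q Q' v v'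
  have h3 := mul_le_mul_of_nonneg_left (by linarith : (1 / 2 : ℝ) ≤ bhattacharyya Q Q' ^ N)
    (norm_nonneg (v - v'))
  linarith

end EstimationProtocol

/-! ### Functions on intervals -/

section Interval

open Set

/-- The Baire category theorem on an open interval: if countably many sets cover it, one of them
is dense in a subinterval. -/
theorem exists_Ioo_subset_closure {a b : ℝ} (hab : a < b) {E : ℕ → Set ℝ}
    (hE : Ioo a b ⊆ ⋃ k, E k) :
    ∃ k a' b', a' < b' ∧ Ioo a' b' ⊆ Ioo a b ∧ Ioo a' b' ⊆ closure (E k) := by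
  let F : Option ℕ → Set ℝ := fun i => i.elim (Ioo a b)ᶜ fun k => closure (E k)
  have hF : ∀ i, IsClosed (F i) := by
    rintro (_ | k)
    · exact isOpen_Ioo.isClosed_compl
    · exact isClosed_closure
  have hU : ⋃ i, F i = univ := by
    refine eq_univ_of_forall fun s => mem_iUnion.2 ?_
    by_cases hs : s ∈ Ioo a b
    · obtain ⟨k, hk⟩ := mem_iUnion.1 (hE hs)
      exact ⟨some k, subset_closure hk⟩
    · exact ⟨none, hs⟩
  obtain ⟨s, hs, hsU⟩ := (dense_iUnion_interior_of_closed hF hU).inter_open_nonempty _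
    isOpen_Ioo (nonempty_Ioo.2 hab)
  obtain ⟨i, hi⟩ := mem_iUnion.1 hsU
  rcases i with _ | k
  · exact absurd hs (interior_subset hi)
  · obtain ⟨a', b', hs', hsub⟩ := mem_nhds_iff_exists_Ioo_subset.1
      ((isOpen_Ioo.inter isOpen_interior).mem_nhds ⟨hs, hi⟩)
    exact ⟨k, a', b', hs'.1.trans hs'.2, fun t ht => (hsub ht).1,
      fun t ht => interior_subset (hsub ht).2⟩

/-- A differentiable function is Lipschitz on some subinterval, although its derivative may be
locally unbounded at many points. -/
theorem exists_Ioo_lipschitz {a b : ℝ} (hab : a < b) {f : ℝ → ℝ}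
    (hf : DifferentiableOn ℝ f (Ioo a b)) :
    ∃ a' b' K : ℝ, a' < b' ∧ Ioo a' b' ⊆ Ioo a b ∧
      ∀ s ∈ Ioo a' b', ∀ t ∈ Ioo a' b', |f s - f t| ≤ K * |s - t| := by
  let E : ℕ → Set ℝ := fun k => {s | ∀ t, |t - s| < 1 / (k + 1 : ℝ) → |f t - f s| ≤ k * |t - s|}
  have hE : Ioo a b ⊆ ⋃ k, E k := by
    intro s hs
    obtain ⟨C, hC⟩ := ((hf.differentiableAt (isOpen_Ioo.mem_nhds hs)).isBigO_sub).bound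
    obtain ⟨ε, hε, hball⟩ := Metric.eventually_nhds_iff.1 hC
    obtain ⟨k₁, hk₁⟩ := exists_nat_ge C
    obtain ⟨k₂, hk₂⟩ := exists_nat_one_div_lt hε
    refine mem_iUnion.2 ⟨max k₁ k₂, fun t ht => ?_⟩
    have h1 : (1 : ℝ) / ((max k₁ k₂ : ℕ) + 1) ≤ 1 / (k₂ + 1) :=
      one_div_le_one_div_of_le (by positivity) (by
        have : (k₂ : ℝ) ≤ (max k₁ k₂ : ℕ) := by exact_mod_cast le_max_right _ _
        linarith)
    have h2 := hball (y := t) (by rw [Real.dist_eq]; linarith)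
    have h3 : (k₁ : ℝ) ≤ (max k₁ k₂ : ℕ) := by exact_mod_cast le_max_left _ _
    exact h2.trans (mul_le_mul_of_nonneg_right (by linarith) (abs_nonneg _))
  obtain ⟨k, c, d, hcd, hsub, hcl⟩ := exists_Ioo_subset_closure hab hE
  have hk : (0 : ℝ) < 1 / (k + 1) := by positivity
  refine ⟨c, min d (c + 1 / (k + 1)), k, lt_min hcd (by linarith), ?_, fun s hs t ht => ?_⟩
  · exact (Ioo_subset_Ioo_right (min_le_left _ _)).trans hsub
  -- `t` is a limit of points of `E k`
  set J := Ioo c (min d (c + 1 / (k + 1 : ℝ))) with hJ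
  have hJsub : J ⊆ Ioo c d := Ioo_subset_Ioo_right (min_le_left _ _)
  have hcont : ContinuousOn f J := hf.continuousOn.mono (hJsub.trans hsub)
  have htE : t ∈ closure (J ∩ E k) := by
    have h := isOpen_Ioo.inter_closure (t := E k) (s := J)
    exact h ⟨ht, hcl (hJsub ht)⟩
  have hct : ContinuousAt f t := hcont.continuousAt (isOpen_Ioo.mem_nhds ht)
  refine ContinuousWithinAt.closure_le htE
    (f := fun u => |f s - f u|) (g := fun u => (k : ℝ) * |s - u|)
    ((continuousAt_const.sub hct).abs.continuousWithinAt)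
    (by fun_prop) fun u hu => ?_
  refine hu.2 s ?_
  have h1 := lt_min_iff.1 hs.2
  have h2 := lt_min_iff.1 hu.1.2
  rw [abs_lt]
  constructor <;> linarith [hs.1, hu.1.1]

/-- A differentiable function either vanishes on the whole interval or has no zeros on some
subinterval, so that its square root is differentiable there. In both cases the square root is
Lipschitz on some subinterval. -/
theorem exists_Ioo_sqrt_lipschitz {a b : ℝ} (hab : a < b) {f : ℝ → ℝ}
    (hf : DifferentiableOn ℝ f (Ioo a b)) :
    ∃ a' b' K : ℝ, a' < b' ∧ Ioo a' b' ⊆ Ioo a b ∧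
      ∀ s ∈ Ioo a' b', ∀ t ∈ Ioo a' b', |√(f s) - √(f t)| ≤ K * |s - t| := by
  by_cases hz : ∀ s ∈ Ioo a b, f s = 0
  · exact ⟨a, b, 0, hab, subset_rfl, fun s hs t ht => by simp [hz s hs, hz t ht]⟩
  push Not at hz
  obtain ⟨s, hs, hfs⟩ := hz
  have hc : ContinuousAt f s := hf.continuousOn.continuousAt (isOpen_Ioo.mem_nhds hs)
  have hev := (hc.eventually_ne hfs).and (isOpen_Ioo.eventually_mem hs)
  obtain ⟨a', b', hs', hsub⟩ := mem_nhds_iff_exists_Ioo_subset.1 hev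
  obtain ⟨a'', b'', K, hab'', hsub'', hK⟩ := exists_Ioo_lipschitz (hs'.1.trans hs'.2)
    (f := fun u => √(f u)) fun u hu =>
      ((hf.differentiableAt (isOpen_Ioo.mem_nhds (hsub hu).2)).sqrt
        (hsub hu).1).differentiableWithinAt
  exact ⟨a'', b'', K, hab'', hsub''.trans fun u hu => (hsub hu).2, hK⟩

/-- One subinterval and one Lipschitz constant serve a finite family of functions. -/
theorem exists_Ioo_sqrt_lipschitz_finset {ι : Type*} (S : Finset ι) {a b : ℝ} (hab : a < b)
    {f : ι → ℝ → ℝ} (hf : ∀ i, DifferentiableOn ℝ (f i) (Ioo a b)) :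
    ∃ a' b' K : ℝ, a' < b' ∧ Ioo a' b' ⊆ Ioo a b ∧ 0 < K ∧
      ∀ i ∈ S, ∀ s ∈ Ioo a' b', ∀ t ∈ Ioo a' b', |√(f i s) - √(f i t)| ≤ K * |s - t| := by
  classical
  induction S using Finset.induction_on with
  | empty => exact ⟨a, b, 1, hab, subset_rfl, one_pos, by simp⟩
  | insert i S _ ih =>
    obtain ⟨c, d, K, hcd, hsub, hK0, hK⟩ := ih
    obtain ⟨c', d', K', hcd', hsub', hK'⟩ := exists_Ioo_sqrt_lipschitz hcd
      ((hf i).mono hsub)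
    refine ⟨c', d', max K K', hcd', hsub'.trans hsub, lt_max_of_lt_left hK0, ?_⟩
    intro j hj s hs t ht
    rcases Finset.mem_insert.1 hj with rfl | hj
    · exact (hK' s hs t ht).trans
        (mul_le_mul_of_nonneg_right (le_max_right _ _) (abs_nonneg _))
    · exact (hK j hj s (hsub' hs) t (hsub' ht)).trans
        (mul_le_mul_of_nonneg_right (le_max_left _ _) (abs_nonneg _))

/-- A `C¹` curve with nonzero initial velocity expands distances, up to a constant, near its
initial point. -/
theorem exists_Ioo_expanding {V : Type*} [NormedAddCommGroup V] [NormedSpace ℝ V] {ε : ℝ}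
    (hε : 0 < ε) {h : ℝ → V} (hh : ContDiffOn ℝ 1 h (Icc 0 ε))
    (hv : derivWithin h (Icc 0 ε) 0 ≠ 0) :
    ∃ b α : ℝ, 0 < b ∧ b ≤ ε ∧ 0 < α ∧
      ∀ s ∈ Ioo 0 b, ∀ t ∈ Ioo 0 b, α * |s - t| ≤ ‖h s - h t‖ := by
  set v := derivWithin h (Icc 0 ε) 0 with hvdef
  have hv0 : 0 < ‖v‖ := norm_pos_iff.2 hv
  have hu : UniqueDiffOn ℝ (Icc 0 ε) := uniqueDiffOn_Icc hε
  have hc : ContinuousOn (derivWithin h (Icc 0 ε)) (Icc 0 ε) :=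
    hh.continuousOn_derivWithin hu le_rfl
  obtain ⟨δ, hδ, hball⟩ := Metric.continuousWithinAt_iff.1 (hc 0 ⟨le_rfl, hε.le⟩) (‖v‖ / 2)
    (by positivity)
  have hsub : Ioo 0 (min δ ε) ⊆ Icc 0 ε :=
    fun s hs => ⟨hs.1.le, (hs.2.trans_le (min_le_right _ _)).le⟩
  refine ⟨min δ ε, ‖v‖ / 2, lt_min hδ hε, min_le_right _ _, by positivity, fun s hs t ht => ?_⟩
  have hder : ∀ u ∈ Ioo 0 (min δ ε), HasDerivWithinAt (fun u => h u - u • v)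
      (derivWithin h (Icc 0 ε) u - v) (Ioo 0 (min δ ε)) u := by
    intro u hu'
    have h1 := ((hh.differentiableOn one_ne_zero u (hsub hu')).hasDerivWithinAt).mono hsub
    have h2 := ((hasDerivWithinAt_id u (Ioo 0 (min δ ε))).smul_const v)
    rw [one_smul] at h2
    exact h1.sub h2
  have hbound := (convex_Ioo 0 (min δ ε)).norm_image_sub_le_of_norm_hasDerivWithin_le hder
    (C := ‖v‖ / 2) (fun u hu' => by
      have h1 := hball (hsub hu') (by
        rw [Real.dist_eq, sub_zero, abs_of_pos hu'.1]
        exact hu'.2.trans_le (min_le_left _ _))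
      rw [dist_eq_norm] at h1
      exact h1.le) ht hs
  have h3 : ‖(s - t) • v‖ ≤ ‖h s - h t‖ + ‖(h s - s • v) - (h t - t • v)‖ := by
    have : (s - t) • v = (h s - h t) - ((h s - s • v) - (h t - t • v)) := by
      rw [sub_smul]; abel
    rw [this]
    exact norm_sub_le _ _
  rw [norm_smul, Real.norm_eq_abs] at h3
  rw [Real.norm_eq_abs] at hbound
  linarith

end Interval

/-! ### Curves in the parameter manifold -/

section Curve

open Set

/-- A nonzero linear map does not vanish in all directions from a point into a set with
interior. -/
theorem exists_mem_apply_sub_ne_zero {E V : Type*} [NormedAddCommGroup E] [NormedSpace ℝ E]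
    [NormedAddCommGroup V] [NormedSpace ℝ V] {L : E →L[ℝ] V} (hL : L ≠ 0) {S : Set E}
    (hS : (interior S).Nonempty) (u : E) : ∃ w ∈ S, L (w - u) ≠ 0 := by
  by_contra! h
  obtain ⟨w, hw⟩ := hS
  refine hL (ContinuousLinearMap.ext fun e => ?_)
  have hlim : Filter.Tendsto (fun t : ℝ => w + t • e) (nhds 0) (nhds w) := by
    have : Continuous fun t : ℝ => w + t • e := by fun_prop
    simpa using this.tendsto 0
  obtain ⟨δ, hδ, hball⟩ := Metric.eventually_nhds_iff.1
    (hlim.eventually (isOpen_interior.mem_nhds hw))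
  have h1 := h _ (interior_subset (hball (y := δ / 2) (by
    rw [Real.dist_eq, sub_zero, abs_of_pos (by positivity)]; linarith)))
  have h2 := h w (interior_subset hw)
  have h3 : (w + (δ / 2) • e - u) = (w - u) + (δ / 2) • e := by abel
  rw [h3, map_add, h2, zero_add, map_smul] at h1
  exact (smul_eq_zero.1 h1).resolve_left (by positivity)

/-- A curve in the manifold along which the estimated quantity moves with positive speed. It is a
short segment in a chart; the image of the model with corners is convex, so the segment may start
at a boundary or corner point. -/
theorem exists_curve_expanding {E : Type*} [NormedAddCommGroup E] [NormedSpace ℝ E]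
    {H : Type*} [TopologicalSpace H] (I : ModelWithCorners ℝ E H)
    {Θ : Type*} [TopologicalSpace Θ] [ChartedSpace H Θ] [IsManifold I 1 Θ]
    {V : Type*} [NormedAddCommGroup V] [NormedSpace ℝ V] {τ : Θ → V}
    (hτ : ContMDiff I 𝓘(ℝ, V) 1 τ) {θ₀ : Θ} (hθ₀ : mfderiv I 𝓘(ℝ, V) τ θ₀ ≠ 0) :
    ∃ (γ : ℝ → Θ) (b α : ℝ), 0 < b ∧ 0 < α ∧
      (∀ q : Θ → ℝ, MDifferentiable I 𝓘(ℝ, ℝ) q → DifferentiableOn ℝ (q ∘ γ) (Ioo 0 b)) ∧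
      ∀ s ∈ Ioo 0 b, ∀ t ∈ Ioo 0 b, α * |s - t| ≤ ‖τ (γ s) - τ (γ t)‖ := by
  set φ := extChartAt I θ₀ with hφ
  set u₀ := φ θ₀ with hu₀
  set L : E →L[ℝ] V := fderivWithin ℝ (τ ∘ φ.symm) (range I) u₀ with hLdef
  have hL : L ≠ 0 := by
    have h := ((hτ θ₀).mdifferentiableAt one_ne_zero).mfderiv
    rw [h] at hθ₀
    exact hθ₀
  obtain ⟨u₁, hu₁, hLu⟩ := exists_mem_apply_sub_ne_zero hL I.nonempty_interior u₀
  have hu₀t : u₀ ∈ φ.target := mem_extChartAt_target θ₀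
  have htr : φ.target ⊆ range I := extChartAt_target_subset_range θ₀
  let c : ℝ → E := fun s => u₀ + s • (u₁ - u₀)
  have hc : ContDiff ℝ 1 c := by fun_prop
  have hcr : ∀ s ∈ Icc (0 : ℝ) 1, c s ∈ range I := fun s hs =>
    I.convex_range.add_smul_sub_mem (htr hu₀t) hu₁ hs
  obtain ⟨ε, hε, hε1, hct⟩ : ∃ ε : ℝ, 0 < ε ∧ ε ≤ 1 ∧ MapsTo c (Icc 0 ε) φ.target := by
    have h := extChartAt_target_mem_nhdsWithin (I := I) θ₀
    rw [Metric.mem_nhdsWithin_iff] at h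
    obtain ⟨r, hr, hsub⟩ := h
    have hc0 : c 0 = u₀ := by simp [c]
    obtain ⟨δ, hδ, hball⟩ := Metric.continuous_iff.1 hc.continuous 0 r hr
    refine ⟨min (δ / 2) 1, lt_min (by positivity) one_pos, min_le_right _ _, fun s hs => ?_⟩
    have hs1 := hs.2.trans (min_le_left _ _)
    refine hsub ⟨?_, hcr s ⟨hs.1, hs.2.trans (min_le_right _ _)⟩⟩
    have h2 := hball s (by rw [Real.dist_eq, sub_zero, abs_of_nonneg hs.1]; linarith)
    rwa [hc0] at h2
  have hgt : ContDiffOn ℝ 1 (τ ∘ φ.symm) φ.target :=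
    contMDiffOn_iff_contDiffOn.1 (hτ.comp_contMDiffOn (contMDiffOn_extChartAt_symm θ₀))
  have hh : ContDiffOn ℝ 1 (τ ∘ φ.symm ∘ c) (Icc 0 ε) := hgt.comp hc.contDiffOn hct
  have hderiv : derivWithin (τ ∘ φ.symm ∘ c) (Icc 0 ε) 0 = L (u₁ - u₀) := by
    have hc0 : c 0 = u₀ := by simp [c]
    have h1 : HasFDerivWithinAt (τ ∘ φ.symm) L (range I) (c 0) := by
      rw [hc0]
      have hd : DifferentiableWithinAt ℝ (τ ∘ φ.symm) (range I) u₀ :=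
        (hgt.differentiableOn one_ne_zero u₀ hu₀t).mono_of_mem_nhdsWithin
          (extChartAt_target_mem_nhdsWithin θ₀)
      exact hd.hasFDerivWithinAt
    have h2 : HasDerivWithinAt c (u₁ - u₀) (Icc 0 ε) 0 := by
      have := ((hasDerivWithinAt_id (0 : ℝ) (Icc 0 ε)).smul_const (u₁ - u₀)).const_add u₀
      simpa [c] using this
    exact (h1.comp_hasDerivWithinAt 0 h2 (fun s hs => htr (hct hs))).derivWithin
      (uniqueDiffOn_Icc hε 0 ⟨le_rfl, hε.le⟩)
  obtain ⟨b, α, hb, hbε, hα, hexp⟩ := exists_Ioo_expanding hε hh (by rwa [hderiv])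
  refine ⟨φ.symm ∘ c, b, α, hb, hα, fun q hq => ?_, hexp⟩
  have h1 : MDifferentiableOn 𝓘(ℝ, E) I φ.symm φ.target :=
    (contMDiffOn_extChartAt_symm θ₀).mdifferentiableOn one_ne_zero
  have h2 : DifferentiableOn ℝ (q ∘ φ.symm) φ.target :=
    mdifferentiableOn_iff_differentiableOn.1 (hq.comp_mdifferentiableOn h1)
  exact h2.comp (hc.differentiable one_ne_zero).differentiableOn fun s hs =>
    hct ⟨hs.1.le, hs.2.le.trans hbε⟩

end Curve

/-! ### Lower bounds on the error -/

section LowerBound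

open Set

variable {m n : ℕ}

/-- A curve of channels with one two-point bound for all protocols: the errors at two of its points
whose parameters differ by `O(1/√N)` add up to at least a constant times this difference. -/
theorem exists_curve_two_point_bound [NeZero m] [NeZero n]
    {E : Type*} [NormedAddCommGroup E] [NormedSpace ℝ E]
    {H : Type*} [TopologicalSpace H] (I : ModelWithCorners ℝ E H)
    {Θ : Type*} [TopologicalSpace Θ] [ChartedSpace H Θ] [IsManifold I 1 Θ]
    {V : Type*} [NormedAddCommGroup V] [NormedSpace ℝ V]
    {Q : Θ → StochasticMatrix m n} {τ : Θ → V}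
    (hQ : ∀ x y, MDifferentiable I 𝓘(ℝ, ℝ) (fun θ => (Q θ).1 x y))
    (hτ : ContMDiff I 𝓘(ℝ, V) 1 τ) (hτ' : ∃ θ, mfderiv I 𝓘(ℝ, V) τ θ ≠ 0) :
    ∃ (γ : ℝ → Θ) (a b α D : ℝ), a < b ∧ 0 < α ∧ 0 < D ∧
      ∀ N : ℕ, 1 ≤ N → ∀ P : EstimationProtocol (Fin m) (Fin n) N V,
        ∀ s ∈ Ioo a b, ∀ t ∈ Ioo a b, D * N * (s - t) ^ 2 ≤ 1 →
          α * |s - t| ≤ P.rmse (dmcChannel (Q (γ s))) (τ (γ s)) +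
            P.rmse (dmcChannel (Q (γ t))) (τ (γ t)) := by
  obtain ⟨θ₀, hθ₀⟩ := hτ'
  obtain ⟨γ, b, α, hb, hα, hγ, hexp⟩ := exists_curve_expanding I hτ hθ₀
  obtain ⟨a', b', K, hab, hsub, hK, hlip⟩ := exists_Ioo_sqrt_lipschitz_finset Finset.univ hb
    (f := fun (i : Fin m × Fin n) s => (Q (γ s)).1 i.1 i.2) fun i => hγ _ (hQ i.1 i.2)
  have hm : (0 : ℝ) < m := by exact_mod_cast Nat.pos_of_ne_zero (NeZero.ne m)
  have hn : (0 : ℝ) < n := by exact_mod_cast Nat.pos_of_ne_zero (NeZero.ne n)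
  refine ⟨γ, a', b', α / 2, m * n * K ^ 2, hab, by positivity, by positivity, ?_⟩
  intro N hN P s hs t ht hst
  have h1 := P.norm_sub_le_two_mul_rmse_add (Q := Q (γ s)) (Q' := Q (γ t)) (d := K * |s - t|)
    (fun x y => hlip (x, y) (Finset.mem_univ _) s hs t ht) hN (by
      rw [mul_pow, sq_abs]
      linarith) (τ (γ s)) (τ (γ t))
  have h2 := hexp s (hsub hs) t (hsub ht)
  linarith

/-- The uniform bound: two points of the curve at distance of order `1/√N` suffice. -/
theorem exists_le_rmse {Θ : Type*} {V : Type*} [NormedAddCommGroup V]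
    {Q : Θ → StochasticMatrix m n} {τ : Θ → V} {γ : ℝ → Θ} {a b α D : ℝ}
    (hab : a < b) (hα : 0 < α) (hD : 0 < D)
    (h : ∀ N : ℕ, 1 ≤ N → ∀ P : EstimationProtocol (Fin m) (Fin n) N V,
        ∀ s ∈ Ioo a b, ∀ t ∈ Ioo a b, D * N * (s - t) ^ 2 ≤ 1 →
          α * |s - t| ≤ P.rmse (dmcChannel (Q (γ s))) (τ (γ s)) +
            P.rmse (dmcChannel (Q (γ t))) (τ (γ t))) :
    ∃ c : ℝ, 0 < c ∧ ∀ N : ℕ, 1 ≤ N → ∀ P : EstimationProtocol (Fin m) (Fin n) N V,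
      ∃ θ, c / √(N : ℝ) ≤ P.rmse (dmcChannel (Q θ)) (τ θ) := by
  set r := min ((b - a) / 3) (1 / √D) with hr
  have hD' : 0 < √D := Real.sqrt_pos.2 hD
  have hr0 : 0 < r := lt_min (by linarith) (by positivity)
  have hDr : D * r ^ 2 ≤ 1 := by
    calc D * r ^ 2 ≤ D * (1 / √D) ^ 2 :=
          mul_le_mul_of_nonneg_left (pow_le_pow_left₀ hr0.le (min_le_right _ _) 2) hD.le
      _ = 1 := by rw [div_pow, Real.sq_sqrt hD.le]; field_simp
  refine ⟨α * r / 2, by positivity, fun N hN P => ?_⟩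
  have hN1 : (1 : ℝ) ≤ N := by exact_mod_cast hN
  have hsN : 1 ≤ √(N : ℝ) := Real.one_le_sqrt.2 hN1
  have hρ0 : 0 < r / √(N : ℝ) := by positivity
  have hρ : r / √(N : ℝ) ≤ (b - a) / 3 := (div_le_self hr0.le hsN).trans (min_le_left _ _)
  have h1 := h N hN P (a + (b - a) / 3 + r / √(N : ℝ)) ⟨by linarith, by linarith⟩
    (a + (b - a) / 3) ⟨by linarith, by linarith⟩ (by
      rw [add_sub_cancel_left, div_pow, Real.sq_sqrt (by linarith)]
      calc D * N * (r ^ 2 / N) = D * r ^ 2 := by field_simp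
        _ ≤ 1 := hDr)
  rw [add_sub_cancel_left, abs_of_pos hρ0] at h1
  have h2 : α * r / 2 / √(N : ℝ) = α * (r / √(N : ℝ)) / 2 := by ring
  by_contra! hcon
  have h3 := hcon (γ (a + (b - a) / 3 + r / √(N : ℝ)))
  have h4 := hcon (γ (a + (b - a) / 3))
  linarith

/-- The pointwise bound. At a single point the error may decay arbitrarily fast. If it were
`o(1/√N)` everywhere, then by the Baire category theorem the error would be small, uniformly in
large `N`, on a dense subset of some interval; this subset has pairs of points at distance of order
`1/√N`, which contradicts the two-point bound. -/
theorem not_forall_rmse_isLittleO {Θ : Type*} {V : Type*} [NormedAddCommGroup V]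
    {Q : Θ → StochasticMatrix m n} {τ : Θ → V} {γ : ℝ → Θ} {a b α D : ℝ}
    (hab : a < b) (hα : 0 < α) (hD : 0 < D)
    (h : ∀ N : ℕ, 1 ≤ N → ∀ P : EstimationProtocol (Fin m) (Fin n) N V,
        ∀ s ∈ Ioo a b, ∀ t ∈ Ioo a b, D * N * (s - t) ^ 2 ≤ 1 →
          α * |s - t| ≤ P.rmse (dmcChannel (Q (γ s))) (τ (γ s)) +
            P.rmse (dmcChannel (Q (γ t))) (τ (γ t))) :
    ¬ ∃ P : ∀ N : ℕ, EstimationProtocol (Fin m) (Fin n) N V,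
      ∀ θ, (fun N : ℕ => (P N).rmse (dmcChannel (Q θ)) (τ θ))
        =o[Filter.atTop] (fun N : ℕ => 1 / √(N : ℝ)) := by
  rintro ⟨P, hP⟩
  have hD' : 0 < √D := Real.sqrt_pos.2 hD
  set r := 1 / √D with hr
  have hr0 : 0 < r := by positivity
  have hDr : D * r ^ 2 = 1 := by
    rw [hr, div_pow, Real.sq_sqrt hD.le]; field_simp
  set κ := α * r / 8 with hκ
  have hκ0 : 0 < κ := by positivity
  obtain ⟨M, a', b', hab', hsub, hcl⟩ := exists_Ioo_subset_closure hab
    (E := fun M => {s | ∀ N ≥ M,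
      (P N).rmse (dmcChannel (Q (γ s))) (τ (γ s)) ≤ κ * (1 / √(N : ℝ))}) (fun s _ => by
      obtain ⟨M, hM⟩ := Filter.eventually_atTop.1 ((hP (γ s)).bound hκ0)
      refine mem_iUnion.2 ⟨M, fun N hN => ?_⟩
      have h1 := hM N hN
      rwa [Real.norm_of_nonneg ((P N).rmse_nonneg _ _),
        Real.norm_of_nonneg (by positivity)] at h1)
  obtain ⟨N, hNM, hN1, hNr⟩ : ∃ N : ℕ, M ≤ N ∧ 1 ≤ N ∧ r / √(N : ℝ) < b' - a' := by
    have hlim : Filter.Tendsto (fun N : ℕ => r / √(N : ℝ)) Filter.atTop (nhds 0) :=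
      Filter.Tendsto.const_div_atTop
        (Real.tendsto_sqrt_atTop.comp tendsto_natCast_atTop_atTop) r
    obtain ⟨N, h1, h2, h3⟩ := ((Filter.eventually_ge_atTop M).and
      ((Filter.eventually_ge_atTop 1).and
        (hlim.eventually_lt_const (sub_pos.2 hab')))).exists
    exact ⟨N, h1, h2, h3⟩
  have hN0 : (0 : ℝ) < N := by exact_mod_cast hN1
  set ρ := r / √(N : ℝ) with hρ
  have hρ0 : 0 < ρ := by positivity
  have hdense : ∀ c d, a' ≤ c → c < d → d ≤ b' → ∃ s ∈ Ioo c d,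
      (P N).rmse (dmcChannel (Q (γ s))) (τ (γ s)) ≤ κ * (1 / √(N : ℝ)) := by
    intro c d hc hcd hd
    have hmid : (c + d) / 2 ∈ Ioo c d := ⟨by linarith, by linarith⟩
    obtain ⟨s, hs, hsE⟩ := mem_closure_iff.1 (hcl (Ioo_subset_Ioo hc hd hmid)) _ isOpen_Ioo hmid
    exact ⟨s, hs, hsE N hNM⟩
  obtain ⟨s, hs, hsκ⟩ := hdense a' (a' + ρ / 4) le_rfl (by linarith) (by linarith)
  obtain ⟨t, ht, htκ⟩ := hdense (a' + 3 * ρ / 4) (a' + ρ) (by linarith) (by linarith) (by linarith)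
  have hdist : |s - t| = t - s := by
    rw [abs_sub_comm, abs_of_pos (by linarith [hs.2, ht.1])]
  have h1 := h N hN1 (P N) s (hsub ⟨hs.1, by linarith [hs.2]⟩) t
    (hsub ⟨by linarith [ht.1], by linarith [ht.2]⟩) (by
      have h2 : (s - t) ^ 2 ≤ ρ ^ 2 := by
        rw [← sq_abs, hdist]
        exact pow_le_pow_left₀ (by linarith [hs.2, ht.1]) (by linarith [hs.1, ht.2]) 2
      calc D * N * (s - t) ^ 2 ≤ D * N * ρ ^ 2 := mul_le_mul_of_nonneg_left h2 (by positivity)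
        _ = D * r ^ 2 := by rw [hρ, div_pow, Real.sq_sqrt hN0.le]; field_simp
        _ ≤ 1 := hDr.le)
  have h3 : κ * (1 / √(N : ℝ)) = α * ρ / 8 := by rw [hκ, hρ]; ring
  have h4 : α * (ρ / 2) ≤ α * |s - t| :=
    mul_le_mul_of_nonneg_left (by rw [hdist]; linarith [hs.2, ht.1]) hα.le
  have h5 : 0 < α * ρ := by positivity
  linarith

end LowerBound


theorem mainTheorem4 (m n : ℕ) [NeZero m] [NeZero n] :
    -- all classical channels with `m` inputs and `n` outputs are programmed by one unitary gate
    (∃ U : Matrix (((Fin m → Fin n) × Fin m) × Fin n) (((Fin m → Fin n) × Fin n) × Fin m) ℂ,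
      U.conjTranspose * U = 1 ∧ U * U.conjTranspose = 1 ∧
      IsProgrammableBy (fun Q : StochasticMatrix m n => dmcChannel Q)
        (fun Q => pureState (programKetBlank Q)) (conjBy U)) ∧
    -- if the gate may be any quantum channel, then the blank register is not needed
    (∃ G : Matrix ((Fin m → Fin n) × Fin m) ((Fin m → Fin n) × Fin m) ℂ →ₗ[ℂ]
        Matrix (((Fin m → Fin n) × Fin m) × Fin n) (((Fin m → Fin n) × Fin m) × Fin n) ℂ,
      IsProgrammableBy (fun Q : StochasticMatrix m n => dmcChannel Q)
        (fun Q => pureState (programKet Q)) G) ∧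
    -- no parameter of a family of classical channels can be estimated faster than `1/√N`
    (∀ {E : Type*} [NormedAddCommGroup E] [NormedSpace ℝ E] [FiniteDimensional ℝ E]
      {H : Type*} [TopologicalSpace H] (I : ModelWithCorners ℝ E H)
      {Θ : Type*} [TopologicalSpace Θ] [ChartedSpace H Θ] [IsManifold I 1 Θ]
      {V : Type*} [NormedAddCommGroup V] [NormedSpace ℝ V]
      (Q : Θ → StochasticMatrix m n) (τ : Θ → V),
      (∀ x y, MDifferentiable I 𝓘(ℝ, ℝ) (fun θ => (Q θ).1 x y)) →
      ContMDiff I 𝓘(ℝ, V) 1 τ →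
      (∃ θ, mfderiv I 𝓘(ℝ, V) τ θ ≠ 0) →
      (∃ c : ℝ, 0 < c ∧ ∀ N : ℕ, 1 ≤ N →
        ∀ P : EstimationProtocol (Fin m) (Fin n) N V,
          ∃ θ, c / √(N : ℝ) ≤ P.rmse (dmcChannel (Q θ)) (τ θ)) ∧
      ¬ ∃ P : ∀ N : ℕ, EstimationProtocol (Fin m) (Fin n) N V,
          ∀ θ, (fun N : ℕ => (P N).rmse (dmcChannel (Q θ)) (τ θ))
            =o[Filter.atTop] (fun N : ℕ => 1 / √(N : ℝ))) := by
  refine ⟨exists_unitary_programmable m n, exists_channel_programmable m n, ?_⟩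
  intro E _ _ _ H _ I Θ _ _ _ V _ _ Q τ hQ hτ hτ'
  obtain ⟨γ, a, b, α, D, hab, hα, hD, h⟩ := exists_curve_two_point_bound I hQ hτ hτ'
  exact ⟨exists_le_rmse hab hα hD h, not_forall_rmse_isLittleO hab hα hD h⟩
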